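/- Let $S^1=\mathbb{R}/\mathbb{Z}$ and let $f\colon S^1\to S^1$ be the map $f(\theta)=\theta+\frac{1}{10}\sin(2\pi\theta)$. Let $L$ be the Lebesgue probability measure on $S^1$, and let $\varphi\colon S^1\to\mathbb{R}$ be the continuous function $\varphi=\max\{\log f',0\}$. Let $\mathcal{M}(S^1)$ be the set of Borel probability measures on $S^1$ with the weak topology, and for $n\ge 1$ put $\mathcal{E}_n(x)=\frac1n\sum_{j=0}^{n-1}\delta_{f^j(x)}\in\mathcal{M}(S^1)$. For $f$-invariant $\mu\in\mathcal{M}(S^1)$ let $h(\mu)$ be its metric (Kolmogorov–Sinai) entropy, and define $$\mathcal{F}_\varphi(\mu)=\begin{cases} h(\mu)-\int\varphi\,d\mu & (\mu \text{ is } f\text{-invariant}),\\ -\infty & (\text{otherwise}).\end{cases}$$ Then: 1. The non-wandering set of $f$ (the set of points $x$ such that for every neighbourhood $U$ of $x$ there is an integer $n>0$ with $U\cap f^{-n}(U)\neq\emptyset$) is $\{0,\frac12\}$. 2. $h(\mu)=0$ for every $f$-invariant Borel probability measure $\mu$ on $S^1$. 3. $(S^1,f)$ satisfies the level-2 large deviation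 principle with reference measure $L$ and rate function $\mathcal{F}_\varphi$. That is, $\mathcal{F}_\varphi$ is upper semicontinuous on $\mathcal{M}(S^1)$ with values in $[-\infty,0]$, for every open $G\subset\mathcal{M}(S^1)$ $$\liminf_{n\to\infty}\frac1n\log L(\{x\in S^1:\mathcal{E}_n(x)\in G\})\ \ge\ \sup_{\mu\in G}\mathcal{F}_\varphi(\mu),$$ and for every closed $F\subset\mathcal{M}(S^1)$ $$\limsup_{n\to\infty}\frac1n\log L(\{x\in S^1:\mathcal{E}_n(x)\in F\})\ \le\ \sup_{\mu\in F}\mathcal{F}_\varphi(\mu),$$ where $\log 0=-\infty$ and $\sup\emptyset=-\infty$. -/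

import Mathlib

open MeasureTheory Filter Topology

namespace LevelTwo

section General

variable {X : Type*} [MeasurableSpace X]

/-- The empirical measure `(1/n) ∑_{j<n} δ_{f^j(x)}`, for `n ≥ 1`, as a Borel probability measure. -/
noncomputable def empiricalMeasure (f : X → X) (n : ℕ) [NeZero n] (x : X) : ProbabilityMeasure X :=
  ⟨(n : ENNReal)⁻¹ • ∑ j ∈ Finset.range n, Measure.dirac (f^[j] x), ⟨by
    have h : (n : ENNReal) ≠ 0 := by exact_mod_cast NeZero.ne n
    simp [ENNReal.inv_mul_cancel h (ENNReal.natCast_ne_top n)]⟩⟩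

/-- `q` is a rate function of a level-2 large deviation principle for `f` with reference
measure `m`: it is upper semicontinuous with values in `[-∞, 0]` and the lower and upper bounds
hold. The space `ProbabilityMeasure X` carries the weak topology; the time `n ≥ 1` is written
`n + 1`; `ENNReal.log 0 = -∞`, and a supremum over the empty set is `-∞`. -/
structure IsRateFunction [TopologicalSpace X] [OpensMeasurableSpace X]
    (f : X → X) (m : ProbabilityMeasure X) (q : ProbabilityMeasure X → EReal) : Prop where
  upperSemicontinuous : UpperSemicontinuous q
  nonpos : ∀ μ, q μ ≤ 0
  lower_bound : ∀ G : Set (ProbabilityMeasure X), IsOpen G →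
    ⨆ μ ∈ G, q μ ≤
      liminf (fun n : ℕ =>
        ENNReal.log ((m : Measure X) {x | empiricalMeasure f (n + 1) x ∈ G}) / ((n + 1 : ℕ) : EReal))
        atTop
  upper_bound : ∀ F : Set (ProbabilityMeasure X), IsClosed F →
    limsup (fun n : ℕ =>
        ENNReal.log ((m : Measure X) {x | empiricalMeasure f (n + 1) x ∈ F}) / ((n + 1 : ℕ) : EReal))
        atTop
      ≤ ⨆ μ ∈ F, q μ

/-- Shannon entropy `-∑ μ(A) log μ(A)` of the finite partition of `X` into the fibres of `ξ`. -/
noncomputable def partitionEntropy {ι : Type*} [Fintype ι] (μ : Measure X) (ξ : X → ι) : ℝ :=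
  ∑ i, Real.negMulLog (μ.real (ξ ⁻¹' {i}))

/-- The labelling map of the joined partition `ξ ∨ f⁻¹ξ ∨ ⋯ ∨ f^{-(n-1)}ξ`. -/
def itinerary {ι : Type*} (f : X → X) (ξ : X → ι) (n : ℕ) (x : X) : Fin n → ι :=
  fun j => ξ (f^[j] x)

/-- The entropy `lim (1/n) H_μ(ξ ∨ ⋯ ∨ f^{-(n-1)}ξ)` of `f` relative to the partition `ξ`
(the limit exists for invariant `μ`, so it is written as a limit superior). -/
noncomputable def entropyRel {ι : Type*} [Fintype ι] (f : X → X) (μ : Measure X) (ξ : X → ι) :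
    EReal :=
  limsup (fun n : ℕ => ((partitionEntropy μ (itinerary f ξ n) / n : ℝ) : EReal)) atTop

/-- The metric (Kolmogorov-Sinai) entropy of `f` with respect to `μ`: the supremum of the relative
entropies over all finite measurable partitions, a partition into (at most) `k` sets being given by
a measurable map to `Fin k`. -/
noncomputable def metricEntropy (f : X → X) (μ : Measure X) : EReal :=
  ⨆ (k : ℕ) (ξ : X → Fin k) (_ : Measurable ξ), entropyRel f μ ξ

open Classical in
/-- The free energy with respect to the continuous function `φ`: `h(μ) - ∫ φ dμ` if `μ` is
`f`-invariant, and `-∞` otherwise. -/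
noncomputable def freeEnergy [TopologicalSpace X] (f : X → X) (φ : C(X, ℝ))
    (μ : ProbabilityMeasure X) : EReal :=
  if MeasurePreserving f (μ : Measure X) (μ : Measure X) then
    metricEntropy f (μ : Measure X) - ((∫ x, φ x ∂(μ : Measure X) : ℝ) : EReal)
  else ⊥

end General

/-- The non-wandering set: the points `x` such that every neighbourhood `U` of `x` meets
`f^{-n}(U)` for some `n > 0`. -/
def nonWanderingSet {X : Type*} [TopologicalSpace X] (f : X → X) : Set X :=
  {x | ∀ U ∈ 𝓝 x, ∃ n : ℕ, 0 < n ∧ (U ∩ f^[n] ⁻¹' U).Nonempty}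

/-- The lift `x ↦ x + (1/10) sin (2πx)` of the circle map to the real line. -/
noncomputable def circleLift (x : ℝ) : ℝ := x + 1 / 10 * Real.sin (2 * Real.pi * x)

theorem circleLift_add_one (x : ℝ) : circleLift (x + 1) = circleLift x + 1 := by
  have h : 2 * Real.pi * (x + 1) = 2 * Real.pi * x + 2 * Real.pi := by ring
  rw [circleLift, circleLift, h, Real.sin_add_two_pi]
  ring

theorem hasDerivAt_circleLift (x : ℝ) :
    HasDerivAt circleLift (1 + Real.pi / 5 * Real.cos (2 * Real.pi * x)) x := by
  have h1 : HasDerivAt (fun y : ℝ => 2 * Real.pi * y) (2 * Real.pi) x := by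
    simpa using (hasDerivAt_id x).const_mul (2 * Real.pi)
  have h2 := (hasDerivAt_id x).add (h1.sin.const_mul (1 / 10))
  exact h2.congr_deriv (by ring)

theorem deriv_circleLift (x : ℝ) :
    deriv circleLift x = 1 + Real.pi / 5 * Real.cos (2 * Real.pi * x) :=
  (hasDerivAt_circleLift x).deriv

theorem deriv_circleLift_pos (x : ℝ) : 0 < deriv circleLift x := by
  rw [deriv_circleLift]
  nlinarith [Real.neg_one_le_cos (2 * Real.pi * x), Real.pi_pos, Real.pi_lt_four]

/-- The map `f(θ) = θ + (1/10) sin (2πθ)` of the circle `ℝ/ℤ`. -/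
noncomputable def circleMap : UnitAddCircle → UnitAddCircle :=
  Function.Periodic.lift (f := fun x : ℝ => (circleLift x : UnitAddCircle)) (c := 1) fun x => by
    change (circleLift (x + 1) : UnitAddCircle) = (circleLift x : UnitAddCircle)
    rw [circleLift_add_one]
    exact AddCircle.coe_add_period 1 (circleLift x)

theorem periodic_circlePotential :
    Function.Periodic (fun x : ℝ => max (Real.log (deriv circleLift x)) 0) 1 := fun x => by
  have h : 2 * Real.pi * (x + 1) = 2 * Real.pi * x + 2 * Real.pi := by ring
  simp only [deriv_circleLift, h, Real.cos_add_two_pi]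

/-- The continuous function `φ = max {log Df, 0}` on the circle, where `Df` is the derivative
of the circle map (the derivative of its lift, which is `1`-periodic and positive). -/
noncomputable def circlePotential : C(UnitAddCircle, ℝ) where
  toFun := Function.Periodic.lift periodic_circlePotential
  continuous_toFun := by
    refine continuous_coinduced_dom.mpr ?_
    change Continuous fun x : ℝ => max (Real.log (deriv circleLift x)) 0
    refine Continuous.max (Continuous.log ?_ fun x => (deriv_circleLift_pos x).ne') continuous_const
    simp only [funext deriv_circleLift]
    fun_prop

/-- Lebesgue measure on the circle `ℝ/ℤ`, as a Borel probability measure. -/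
noncomputable def lebesgueCircle : ProbabilityMeasure UnitAddCircle :=
  ⟨volume, ⟨by simp⟩⟩

end LevelTwo

namespace LevelTwo

/-! The distance `‖x‖ ∈ [0, 1/2]` to the fixed point `0` satisfies `‖f x‖ = circleLift ‖x‖` and
strictly increases along every orbit off the two fixed points. It is therefore a strict Lyapunov
function: recurrence is impossible elsewhere, and an invariant measure, for which `‖f x‖ - ‖x‖` has
integral zero, is a mixture `t δ₀ + (1 - t) δ_{1/2}`. Two atoms carry no entropy, and the potential
equals `log multiplier` at `0` and vanishes at `1/2`, so the free energy of the mixture is `-t * log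
multiplier`.

The large deviation principle thus reduces to one real variable. An orbit spends a uniformly bounded
time away from the fixed points, so its empirical measure is uniformly close to `fixedMix t`, with
`t` the fraction of time spent in the quarter ball (`eventually_empiricalMeasure_mem`). By
monotonicity that time is an initial block. Staying near `0` for `k` steps means, on the exponential
scale, that `‖x‖` is at most `multiplier ^ (-k)`: `norm_iterate_le` gives one direction, and
`exists_norm_mul_pow_le` the other, with any rate `a < multiplier`. Taking `k ≈ t n`, Lebesgue
measure sees such points with exponential rate `-t * log multiplier`. Losing a little in `a` is
harmless because the large deviation bounds only require limits of rates. -/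

/-- The multiplier of the repelling fixed point `0` of the circle map. -/
noncomputable def multiplier : ℝ := 1 + Real.pi / 5

theorem one_lt_multiplier : 1 < multiplier := by
  have := Real.pi_pos
  unfold multiplier; linarith

theorem multiplier_pos : 0 < multiplier := one_pos.trans one_lt_multiplier

/-! ### The lift as an interval map of `[0, 1/2]` -/

theorem strictMono_circleLift : StrictMono circleLift :=
  strictMono_of_deriv_pos deriv_circleLift_pos

theorem continuous_circleLift : Continuous circleLift :=
  continuous_iff_continuousAt.2 fun x => (hasDerivAt_circleLift x).continuousAt

theorem circleLift_neg (x : ℝ) : circleLift (-x) = -circleLift x := by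
  simp only [circleLift, mul_neg, Real.sin_neg]; ring

theorem circleLift_zero : circleLift 0 = 0 := by simp [circleLift]

theorem circleLift_half : circleLift (1 / 2) = 1 / 2 := by
  have h : 2 * Real.pi * (1 / 2) = Real.pi := by ring
  rw [circleLift, h, Real.sin_pi]; ring

theorem circleLift_nonneg {r : ℝ} (h : 0 ≤ r) : 0 ≤ circleLift r := by
  simpa [circleLift_zero] using strictMono_circleLift.monotone h

theorem circleLift_le_half {r : ℝ} (h : r ≤ 1 / 2) : circleLift r ≤ 1 / 2 := by
  exact (strictMono_circleLift.monotone h).trans_eq circleLift_half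

theorem lt_circleLift {r : ℝ} (h0 : 0 < r) (h1 : r < 1 / 2) : r < circleLift r := by
  have : 0 < Real.sin (2 * Real.pi * r) :=
    Real.sin_pos_of_pos_of_lt_pi (by have := Real.pi_pos; positivity)
      (by nlinarith [Real.pi_pos])
  unfold circleLift; linarith

theorem le_circleLift {r : ℝ} (h0 : 0 ≤ r) (h1 : r ≤ 1 / 2) : r ≤ circleLift r := by
  rcases h0.eq_or_lt with rfl | h0
  · rw [circleLift_zero]
  rcases h1.eq_or_lt with rfl | h1
  · rw [circleLift_half]
  exact (lt_circleLift h0 h1).le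

theorem circleLift_le_mul {r : ℝ} (h0 : 0 ≤ r) : circleLift r ≤ multiplier * r := by
  have := Real.sin_le (x := 2 * Real.pi * r) (by have := Real.pi_pos; positivity)
  unfold circleLift multiplier; linarith

/-- Differentiability at `0` alone gives expansion by any factor below the multiplier, which
suffices for exponential rates; no distortion estimate is needed. -/
theorem exists_mul_le_circleLift {a : ℝ} (ha : a < multiplier) :
    ∃ δ > 0, ∀ r, 0 ≤ r → r < δ → a * r ≤ circleLift r := by
  have hd : HasDerivAt circleLift multiplier 0 := by
    simpa [multiplier] using hasDerivAt_circleLift 0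
  have h := (hasDerivAt_iff_tendsto_slope.1 hd).eventually_const_lt ha
  obtain ⟨δ, hδ, H⟩ := Metric.eventually_nhds_iff.1 (eventually_nhdsWithin_iff.1 h)
  refine ⟨δ, hδ, fun r hr0 hr => ?_⟩
  rcases hr0.eq_or_lt with rfl | hr0
  · simp [circleLift_zero]
  have := H (y := r) (by simpa [abs_of_pos hr0] using hr) hr0.ne'
  rw [slope_def_field, circleLift_zero, sub_zero, sub_zero, lt_div_iff₀ hr0] at this
  exact this.le

/-! ### The norm as a Lyapunov function; the non-wandering set -/

theorem circleMap_coe (x : ℝ) : circleMap (x : UnitAddCircle) = (circleLift x : UnitAddCircle) :=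
  rfl

theorem continuous_circleMap : Continuous circleMap := by
  refine continuous_coinduced_dom.mpr ?_
  change Continuous fun x : ℝ => (circleLift x : UnitAddCircle)
  exact (AddCircle.continuous_mk' 1).comp continuous_circleLift

theorem norm_coe_eq_abs {r : ℝ} (h : |r| ≤ 1 / 2) : ‖(r : UnitAddCircle)‖ = |r| :=
  (AddCircle.norm_coe_eq_abs_iff 1 one_ne_zero).2 (by simpa using h)

theorem norm_le_half (x : UnitAddCircle) : ‖x‖ ≤ 1 / 2 := by
  simpa using AddCircle.norm_le_half_period 1 (x := x) one_ne_zero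

theorem exists_rep (x : UnitAddCircle) : ∃ r : ℝ, |r| ≤ 1 / 2 ∧ (r : UnitAddCircle) = x := by
  induction x using QuotientAddGroup.induction_on with | H r => ?_
  refine ⟨r - round r, by simpa using abs_sub_round r, ?_⟩
  rw [AddCircle.coe_sub, sub_eq_self, AddCircle.coe_eq_zero_iff]
  exact ⟨round r, by simp⟩

/-- The lift is odd and preserves `[0, 1/2]`, so the dynamics of the distance to `0` is an
autonomous interval map. -/
theorem norm_circleMap (x : UnitAddCircle) : ‖circleMap x‖ = circleLift ‖x‖ := by
  obtain ⟨r, hr, rfl⟩ := exists_rep x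
  have habs : circleLift |r| = |circleLift r| := by
    rcases le_total 0 r with h | h
    · rw [abs_of_nonneg h, abs_of_nonneg (circleLift_nonneg h)]
    · have := circleLift_nonneg (neg_nonneg.2 h)
      rw [circleLift_neg] at this
      rw [abs_of_nonpos h, circleLift_neg, abs_of_nonpos (neg_nonneg.1 this)]
  rw [circleMap_coe, norm_coe_eq_abs hr, habs, norm_coe_eq_abs]
  rw [← habs]
  exact circleLift_le_half hr

theorem norm_half : ‖((1 / 2 : ℝ) : UnitAddCircle)‖ = 1 / 2 := by
  rw [norm_coe_eq_abs] <;> norm_num [abs_of_pos]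

theorem eq_half_of_norm {x : UnitAddCircle} (h : ‖x‖ = 1 / 2) : x = ((1 / 2 : ℝ) : UnitAddCircle) := by
  obtain ⟨r, hr, rfl⟩ := exists_rep x
  rw [norm_coe_eq_abs hr] at h
  rcases (abs_eq (by norm_num)).1 h with rfl | rfl
  · rfl
  · rw [← sub_eq_zero, ← AddCircle.coe_sub, AddCircle.coe_eq_zero_iff]
    exact ⟨-1, by norm_num⟩

theorem circleMap_zero : circleMap 0 = 0 := by
  rw [← norm_eq_zero, norm_circleMap, norm_zero, circleLift_zero]

theorem circleMap_half :
    circleMap ((1 / 2 : ℝ) : UnitAddCircle) = ((1 / 2 : ℝ) : UnitAddCircle) := by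
  rw [circleMap_coe, circleLift_half]

theorem zero_ne_half : (0 : UnitAddCircle) ≠ ((1 / 2 : ℝ) : UnitAddCircle) := by
  intro h
  have := congrArg norm h
  rw [norm_half] at this
  norm_num at this

theorem norm_le_norm_circleMap (x : UnitAddCircle) : ‖x‖ ≤ ‖circleMap x‖ := by
  rw [norm_circleMap]
  exact le_circleLift (norm_nonneg x) (norm_le_half x)

theorem norm_lt_norm_circleMap {x : UnitAddCircle} (h0 : x ≠ 0)
    (h1 : x ≠ ((1 / 2 : ℝ) : UnitAddCircle)) : ‖x‖ < ‖circleMap x‖ := by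
  rw [norm_circleMap]
  exact lt_circleLift (norm_pos_iff.2 h0)
    (lt_of_le_of_ne (norm_le_half x) fun h => h1 (eq_half_of_norm h))

theorem monotone_norm_iterate (x : UnitAddCircle) : Monotone fun j => ‖circleMap^[j] x‖ :=
  monotone_nat_of_le_succ fun j => by
    rw [Function.iterate_succ_apply']
    exact norm_le_norm_circleMap _

theorem nonWanderingSet_circleMap :
    nonWanderingSet circleMap = {0, ((1 / 2 : ℝ) : UnitAddCircle)} := by
  ext x
  simp only [Set.mem_insert_iff, Set.mem_singleton_iff]
  constructor
  · intro hx
    by_contra! hne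
    -- Near `x` the norm is below `c` now and above `c` after one step; by monotonicity the orbit
    -- never returns below `c`.
    obtain ⟨c, hc1, hc2⟩ := exists_between (norm_lt_norm_circleMap hne.1 hne.2)
    have hU : {y : UnitAddCircle | ‖y‖ < c ∧ c < ‖circleMap y‖} ∈ 𝓝 x :=
      ((isOpen_lt continuous_norm continuous_const).inter
        (isOpen_lt continuous_const continuous_circleMap.norm)).mem_nhds ⟨hc1, hc2⟩
    obtain ⟨n, hn, y, hy, hny⟩ := hx _ hU
    have := monotone_norm_iterate y (Nat.succ_le_of_lt hn)
    simp only [Nat.succ_eq_add_one, zero_add, Function.iterate_one] at this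
    exact absurd (hy.2.trans_le this) hny.1.not_gt
  · rintro (rfl | rfl) U hU
    · exact ⟨1, one_pos, 0, mem_of_mem_nhds hU, by simpa [circleMap_zero] using mem_of_mem_nhds hU⟩
    · refine ⟨1, one_pos, _, mem_of_mem_nhds hU, ?_⟩
      rw [Function.iterate_one, Set.mem_preimage, circleMap_half]
      exact mem_of_mem_nhds hU

/-! ### Time spent away from and near the fixed points -/

/-- The orbit of `x` spends a bounded time away from the two fixed points. -/
theorem exists_card_intermediate_le {δ : ℝ} (hδ : 0 < δ) :
    ∃ C : ℕ, ∀ (x : UnitAddCircle) (n : ℕ),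
      ((Finset.range n).filter fun j =>
        δ ≤ ‖circleMap^[j] x‖ ∧ ‖circleMap^[j] x‖ ≤ 1 / 2 - δ).card ≤ C := by
  -- By compactness each visit to the intermediate region raises the norm by at least `η`; the total
  -- rise telescopes and is at most `1/2`, which bounds the number of visits.
  obtain ⟨η, hη, H⟩ := (isCompact_Icc (a := δ) (b := 1 / 2 - δ)).exists_forall_le'
    (f := fun r => circleLift r - r) (by have := continuous_circleLift; fun_prop) (a := 0)
    fun r hr => sub_pos.2 (lt_circleLift (hδ.trans_le hr.1) (by linarith [hr.2]))
  refine ⟨⌈1 / η⌉₊, fun x n => ?_⟩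
  set S := (Finset.range n).filter fun j =>
        δ ≤ ‖circleMap^[j] x‖ ∧ ‖circleMap^[j] x‖ ≤ 1 / 2 - δ with hS
  have h1 : S.card • η ≤ ∑ j ∈ S, (‖circleMap^[j + 1] x‖ - ‖circleMap^[j] x‖) := by
    refine Finset.card_nsmul_le_sum _ _ _ fun j hj => ?_
    rw [Function.iterate_succ_apply', norm_circleMap]
    exact H _ (Finset.mem_filter.1 hj).2
  have h2 : ∑ j ∈ S, (‖circleMap^[j + 1] x‖ - ‖circleMap^[j] x‖) ≤
      ∑ j ∈ Finset.range n, (‖circleMap^[j + 1] x‖ - ‖circleMap^[j] x‖) :=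
    Finset.sum_le_sum_of_subset_of_nonneg (Finset.filter_subset _ _) fun j _ _ =>
      sub_nonneg.2 (monotone_norm_iterate x j.le_succ)
  rw [Finset.sum_range_sub (fun j => ‖circleMap^[j] x‖), Function.iterate_zero, id] at h2
  rw [nsmul_eq_mul] at h1
  have h3 : (S.card : ℝ) ≤ 1 / η := by
    rw [le_div_iff₀ hη]
    linarith [norm_le_half (circleMap^[n] x), norm_nonneg x]
  exact_mod_cast h3.trans (Nat.le_ceil _)

theorem norm_iterate_le (x : UnitAddCircle) (k : ℕ) :
    ‖circleMap^[k] x‖ ≤ multiplier ^ k * ‖x‖ := by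
  induction k with
  | zero => simp
  | succ k ih =>
    rw [Function.iterate_succ_apply', norm_circleMap, pow_succ']
    calc _ ≤ multiplier * ‖circleMap^[k] x‖ := circleLift_le_mul (norm_nonneg _)
      _ ≤ multiplier * (multiplier ^ k * ‖x‖) := by gcongr; exact multiplier_pos.le
      _ = _ := by ring

/-- An orbit that stays in the quarter ball up to time `k` starts exponentially close to `0`. -/
theorem exists_norm_mul_pow_le {a : ℝ} (ha1 : 1 < a) (ha : a < multiplier) :
    ∃ C ≥ 1, ∀ (x : UnitAddCircle) (k : ℕ), ‖circleMap^[k] x‖ < 1 / 4 → ‖x‖ * a ^ k ≤ C := by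
  obtain ⟨δ₀, hδ₀, H⟩ := exists_mul_le_circleLift ha
  set δ := min δ₀ (1 / 4) with hδ
  have hδpos : 0 < δ := lt_min hδ₀ (by norm_num)
  obtain ⟨C, hC⟩ := exists_card_intermediate_le hδpos
  refine ⟨a ^ C, one_le_pow₀ ha1.le, fun x k hk => ?_⟩
  -- Each visit to the `δ`-ball expands the norm by at least `a`; the other steps do not shrink it.
  have key : ∀ n, ‖x‖ * a ^ ((Finset.range n).filter fun j => ‖circleMap^[j] x‖ < δ).card ≤
      ‖circleMap^[n] x‖ := by
    intro n
    induction n with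
    | zero => simp
    | succ n ih =>
      rw [Finset.range_add_one, Finset.filter_insert]
      split_ifs with hn
      · rw [Finset.card_insert_of_notMem (by simp), pow_succ, Function.iterate_succ_apply',
          norm_circleMap]
        have := H _ (norm_nonneg _) (hn.trans_le (min_le_left _ _))
        nlinarith
      · exact ih.trans (monotone_norm_iterate x n.le_succ)
  -- Before time `k` the norm is below `1/4 ≤ 1/2 - δ`, so every step outside the `δ`-ball is
  -- intermediate, and there are at most `C` of those.
  have hcard : k ≤ ((Finset.range k).filter fun j => ‖circleMap^[j] x‖ < δ).card + C := by
    have h1 := Finset.card_filter_add_card_filter_not (s := Finset.range k)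
      (fun j => ‖circleMap^[j] x‖ < δ)
    have h2 : ((Finset.range k).filter fun j => ¬ ‖circleMap^[j] x‖ < δ).card ≤ C := by
      refine (Finset.card_le_card fun j hj => ?_).trans (hC x k)
      simp only [Finset.mem_filter, Finset.mem_range, not_lt] at hj ⊢
      refine ⟨hj.1, hj.2, ?_⟩
      have := monotone_norm_iterate x hj.1.le
      have := min_le_right δ₀ (1 / 4)
      simp only at *
      linarith
    rw [Finset.card_range] at h1
    omega
  calc ‖x‖ * a ^ k
      ≤ ‖x‖ * a ^ (((Finset.range k).filter fun j => ‖circleMap^[j] x‖ < δ).card + C) := by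
        gcongr; exact ha1.le
    _ = (‖x‖ * a ^ ((Finset.range k).filter fun j => ‖circleMap^[j] x‖ < δ).card) * a ^ C := by
        ring
    _ ≤ 1 * a ^ C := by
        gcongr
        linarith [key k]
    _ = a ^ C := one_mul _


/-! ### Invariant measures -/

/-- The invariant measure `t δ₀ + (1 - t) δ_{1/2}`. -/
noncomputable def fixedMix (t : unitInterval) : ProbabilityMeasure UnitAddCircle :=
  ⟨ENNReal.ofReal t • Measure.dirac 0 +
    ENNReal.ofReal (1 - t) • Measure.dirac ((1 / 2 : ℝ) : UnitAddCircle), ⟨by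
      simp [← ENNReal.ofReal_add t.2.1 (sub_nonneg.2 t.2.2)]⟩⟩

theorem coe_fixedMix (t : unitInterval) :
    (fixedMix t : Measure UnitAddCircle) = ENNReal.ofReal t • Measure.dirac 0 +
      ENNReal.ofReal (1 - t) • Measure.dirac ((1 / 2 : ℝ) : UnitAddCircle) := rfl

theorem integral_fixedMix (t : unitInterval) (g : UnitAddCircle → ℝ) (hg : Continuous g) :
    ∫ x, g x ∂(fixedMix t : Measure UnitAddCircle) =
      t * g 0 + (1 - t) * g ((1 / 2 : ℝ) : UnitAddCircle) := by
  have hi : ∀ ν : Measure UnitAddCircle, IsFiniteMeasure ν → Integrable g ν := fun ν _ =>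
    BoundedContinuousFunction.integrable ν (BoundedContinuousFunction.mkOfCompact ⟨g, hg⟩)
  rw [coe_fixedMix, integral_add_measure ((hi _ inferInstance).smul_measure ENNReal.ofReal_ne_top)
    ((hi _ inferInstance).smul_measure ENNReal.ofReal_ne_top), integral_smul_measure,
    integral_smul_measure, integral_dirac, integral_dirac, ENNReal.toReal_ofReal t.2.1,
    ENNReal.toReal_ofReal (sub_nonneg.2 t.2.2), smul_eq_mul, smul_eq_mul]

theorem continuous_fixedMix : Continuous fixedMix := by
  refine continuous_iff_continuousAt.2 fun t => ?_
  refine ProbabilityMeasure.tendsto_iff_forall_integral_tendsto.2 fun g => ?_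
  simp only [integral_fixedMix _ _ g.continuous]
  exact Continuous.tendsto (by fun_prop) t

theorem measurePreserving_fixedMix (t : unitInterval) :
    MeasurePreserving circleMap (fixedMix t : Measure UnitAddCircle)
      (fixedMix t : Measure UnitAddCircle) := by
  have hm := continuous_circleMap.measurable
  refine ⟨hm, ?_⟩
  rw [coe_fixedMix, Measure.map_add _ _ hm, Measure.map_smul, Measure.map_smul,
    Measure.map_dirac' hm, Measure.map_dirac' hm, circleMap_zero, circleMap_half]

/-- The nonnegative function `‖f x‖ - ‖x‖` integrates to zero by invariance, hence vanishes almost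
everywhere, and its only zeros are the fixed points. -/
theorem ae_eq_fixed_of_measurePreserving {μ : Measure UnitAddCircle} [IsProbabilityMeasure μ]
    (h : MeasurePreserving circleMap μ μ) :
    ∀ᵐ x ∂μ, x = 0 ∨ x = ((1 / 2 : ℝ) : UnitAddCircle) := by
  have hi : Integrable (fun x : UnitAddCircle => ‖x‖) μ :=
    BoundedContinuousFunction.integrable μ
      (BoundedContinuousFunction.mkOfCompact ⟨fun x : UnitAddCircle => ‖x‖, continuous_norm⟩)
  have hi' : Integrable (fun x : UnitAddCircle => ‖circleMap x‖) μ := h.integrable_comp_of_integrable hi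
  have h0 : ∫ x, (‖circleMap x‖ - ‖x‖) ∂μ = 0 := by
    rw [integral_sub hi' hi, sub_eq_zero]
    have := integral_map (μ := μ) h.measurable.aemeasurable
      (f := fun x : UnitAddCircle => ‖x‖) continuous_norm.aestronglyMeasurable
    rw [h.map_eq] at this
    exact this.symm
  have := (integral_eq_zero_iff_of_nonneg
    (fun x => sub_nonneg.2 (norm_le_norm_circleMap x)) (hi'.sub hi)).1 h0
  filter_upwards [this] with x hx
  by_contra! hne
  exact (sub_pos.2 (norm_lt_norm_circleMap hne.1 hne.2)).ne' hx

theorem exists_eq_fixedMix (μ : ProbabilityMeasure UnitAddCircle)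
    (h : MeasurePreserving circleMap (μ : Measure UnitAddCircle) (μ : Measure UnitAddCircle)) :
    ∃ t, μ = fixedMix t := by
  have hae := ae_eq_fixed_of_measurePreserving h
  set ν : Measure UnitAddCircle := (μ : Measure UnitAddCircle) with hν
  refine ⟨⟨ν.real {0}, measureReal_nonneg, measureReal_le_one⟩, ?_⟩
  have hc : ν.real {((1 / 2 : ℝ) : UnitAddCircle)} = 1 - ν.real {0} := by
    rw [← probReal_compl_eq_one_sub (measurableSet_singleton _)]
    refine measureReal_congr ?_
    filter_upwards [hae] with x hx
    refine propext ⟨?_, ?_⟩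
    · rintro rfl
      exact zero_ne_half.symm
    · exact fun hx0 => hx.resolve_left hx0
  apply Subtype.ext
  change ν = (fixedMix _ : Measure UnitAddCircle)
  rw [coe_fixedMix]
  simp only
  rw [← hc, ofReal_measureReal, ofReal_measureReal]
  have h1 : ν = ν.restrict ({0} ∪ {((1 / 2 : ℝ) : UnitAddCircle)}) :=
    (Measure.restrict_eq_self_of_ae_mem (by simpa [or_comm] using hae)).symm
  conv_lhs => rw [h1]
  rw [Measure.restrict_union (by simpa using zero_ne_half) (measurableSet_singleton _),
    Measure.restrict_singleton, Measure.restrict_singleton]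

/-! ### Entropy and free energy -/

/-- A partition of a space carrying a measure concentrated on two points has entropy at most `2`. -/
theorem partitionEntropy_le_two {X : Type*} [MeasurableSpace X] {μ : Measure X}
    [IsProbabilityMeasure μ] {a b : X} (h : ∀ᵐ x ∂μ, x = a ∨ x = b) {ι : Type*} [Fintype ι]
    (ξ : X → ι) : partitionEntropy μ ξ ≤ 2 := by
  classical
  -- Only the labels of the two atoms contribute, however many labels there are.
  have hzero : ∀ i ∉ ({ξ a, ξ b} : Finset ι), Real.negMulLog (μ.real (ξ ⁻¹' {i})) = 0 := by
    intro i hi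
    have : μ (ξ ⁻¹' {i}) = 0 := by
      refine measure_mono_null (fun x hx => ?_) h
      rintro (rfl | rfl) <;> simp_all
    simp [measureReal_def, this]
  rw [partitionEntropy, ← Finset.sum_subset (Finset.subset_univ _) fun i _ hi => hzero i hi]
  have hone : ∀ i ∈ ({ξ a, ξ b} : Finset ι), Real.negMulLog (μ.real (ξ ⁻¹' {i})) ≤ 1 := by
    intro i _
    rcases (measureReal_nonneg (μ := μ) (s := ξ ⁻¹' {i})).eq_or_lt with h0 | h0
    · simp [← h0]
    · have h1 := Real.one_sub_inv_le_log_of_pos h0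
      have h2 := mul_le_mul_of_nonneg_left h1 h0.le
      rw [mul_sub, mul_inv_cancel₀ h0.ne'] at h2
      rw [Real.negMulLog]
      linarith
  refine (Finset.sum_le_card_nsmul _ _ 1 hone).trans ?_
  have := Finset.card_le_two (a := ξ a) (b := ξ b)
  rw [nsmul_eq_mul, mul_one]
  exact_mod_cast this

theorem partitionEntropy_nonneg {X : Type*} [MeasurableSpace X] {μ : Measure X}
    [IsProbabilityMeasure μ] {ι : Type*} [Fintype ι] (ξ : X → ι) : 0 ≤ partitionEntropy μ ξ :=
  Finset.sum_nonneg fun _ _ => Real.negMulLog_nonneg measureReal_nonneg measureReal_le_one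

/-- The entropy of the joined partition stays bounded by `2` for all `n`, so dividing by `n` kills
it. -/
theorem entropyRel_eq_zero {X : Type*} [MeasurableSpace X] {μ : Measure X}
    [IsProbabilityMeasure μ] {a b : X} (h : ∀ᵐ x ∂μ, x = a ∨ x = b) (f : X → X)
    {ι : Type*} [Fintype ι] (ξ : X → ι) : entropyRel f μ ξ = 0 := by
  have ht : Tendsto (fun n : ℕ => partitionEntropy μ (itinerary f ξ n) / n) atTop (𝓝 0) :=
    squeeze_zero (fun n => div_nonneg (partitionEntropy_nonneg _) n.cast_nonneg)
      (fun n => div_le_div_of_nonneg_right (partitionEntropy_le_two h _) n.cast_nonneg)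
      (tendsto_const_div_atTop_nhds_zero_nat 2)
  exact ((continuous_coe_real_ereal.tendsto 0).comp ht).limsup_eq

theorem metricEntropy_eq_zero {X : Type*} [MeasurableSpace X] {μ : Measure X}
    [IsProbabilityMeasure μ] {a b : X} (h : ∀ᵐ x ∂μ, x = a ∨ x = b) (f : X → X) :
    metricEntropy f μ = 0 := by
  refine le_antisymm ?_ ?_
  · exact iSup_le fun k => iSup_le fun ξ => iSup_le fun _ => (entropyRel_eq_zero h f ξ).le
  · rw [← entropyRel_eq_zero h f (fun _ => (0 : Fin 1))]
    exact le_iSup_of_le 1 (le_iSup_of_le _ (le_iSup_of_le measurable_const le_rfl))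

theorem metricEntropy_circleMap (μ : ProbabilityMeasure UnitAddCircle)
    (h : MeasurePreserving circleMap (μ : Measure UnitAddCircle) (μ : Measure UnitAddCircle)) :
    metricEntropy circleMap (μ : Measure UnitAddCircle) = 0 :=
  metricEntropy_eq_zero (ae_eq_fixed_of_measurePreserving h) _

theorem circlePotential_coe (x : ℝ) :
    circlePotential (x : UnitAddCircle) = max (Real.log (deriv circleLift x)) 0 := rfl

theorem circlePotential_zero : circlePotential 0 = Real.log multiplier := by
  have := circlePotential_coe 0
  rw [deriv_circleLift, mul_zero, Real.cos_zero, mul_one] at this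
  exact this.trans (max_eq_left (Real.log_nonneg one_lt_multiplier.le))

theorem circlePotential_half : circlePotential ((1 / 2 : ℝ) : UnitAddCircle) = 0 := by
  have h : 2 * Real.pi * (1 / 2) = Real.pi := by ring
  have hpos := deriv_circleLift_pos (1 / 2)
  rw [circlePotential_coe]
  refine max_eq_right (Real.log_nonpos hpos.le ?_)
  rw [deriv_circleLift, h, Real.cos_pi]
  linarith [Real.pi_pos]

theorem freeEnergy_fixedMix (t : unitInterval) :
    freeEnergy circleMap circlePotential (fixedMix t) =
      ((-(t * Real.log multiplier) : ℝ) : EReal) := by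
  rw [freeEnergy, if_pos (measurePreserving_fixedMix t),
    metricEntropy_circleMap _ (measurePreserving_fixedMix t),
    integral_fixedMix _ _ circlePotential.continuous, circlePotential_zero, circlePotential_half,
    mul_zero, add_zero, zero_sub, EReal.coe_neg]

theorem freeEnergy_eq_bot_or (μ : ProbabilityMeasure UnitAddCircle) :
    freeEnergy circleMap circlePotential μ = ⊥ ∨ ∃ t, μ = fixedMix t := by
  by_cases h : MeasurePreserving circleMap (μ : Measure UnitAddCircle) (μ : Measure UnitAddCircle)
  · exact Or.inr (exists_eq_fixedMix μ h)
  · exact Or.inl (if_neg h)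

theorem freeEnergy_nonpos (μ : ProbabilityMeasure UnitAddCircle) :
    freeEnergy circleMap circlePotential μ ≤ 0 := by
  rcases freeEnergy_eq_bot_or μ with h | ⟨t, rfl⟩
  · simp [h]
  · rw [freeEnergy_fixedMix]
    exact_mod_cast neg_nonpos.2 (mul_nonneg t.2.1 (Real.log_nonneg one_lt_multiplier.le))

theorem upperSemicontinuous_freeEnergy :
    UpperSemicontinuous (freeEnergy circleMap circlePotential) := by
  refine upperSemicontinuous_iff_isClosed_preimage.2 fun c => ?_
  rcases eq_bot_or_bot_lt c with rfl | hc
  · simp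
  -- Above `⊥` only mixtures occur, so the superlevel set is a continuous image of a compact set of
  -- parameters, hence closed.
  have : freeEnergy circleMap circlePotential ⁻¹' Set.Ici c =
      fixedMix '' {t | c ≤ ((-(t * Real.log multiplier) : ℝ) : EReal)} := by
    ext μ
    constructor
    · intro hμ
      rcases freeEnergy_eq_bot_or μ with h | ⟨t, rfl⟩
      · exact absurd (hc.trans_le hμ) (by simp [h])
      · exact ⟨t, le_of_le_of_eq (Set.mem_Ici.1 hμ) (freeEnergy_fixedMix t), rfl⟩
    · rintro ⟨t, ht, rfl⟩
      exact ht.trans_eq (freeEnergy_fixedMix t).symm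
  rw [this]
  refine (IsClosed.isCompact ?_).image continuous_fixedMix |>.isClosed
  exact isClosed_le continuous_const (continuous_coe_real_ereal.comp (by fun_prop))


/-! ### Empirical measures compared with mixtures -/

/-- The number of times `j < n` at which the orbit of `x` is in the quarter ball about `0`. -/
noncomputable def nearCount (n : ℕ) (x : UnitAddCircle) : ℕ :=
  ((Finset.range n).filter fun j => ‖circleMap^[j] x‖ < 1 / 4).card

theorem nearCount_le (n : ℕ) (x : UnitAddCircle) : nearCount n x ≤ n := by
  simpa [nearCount] using Finset.card_filter_le (Finset.range n) fun j => ‖circleMap^[j] x‖ < 1 / 4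

/-- Since the norm is monotone along orbits, the times in the quarter ball form an initial segment,
so `nearCount` is the escape time truncated at `n`. -/
theorem norm_iterate_lt_of_lt_nearCount {n k : ℕ} {x : UnitAddCircle} (h : k < nearCount n x) :
    ‖circleMap^[k] x‖ < 1 / 4 := by
  by_contra! hk
  refine h.not_ge ?_
  calc nearCount n x ≤ (Finset.range k).card := Finset.card_le_card fun j hj => by
        rw [Finset.mem_filter] at hj
        rw [Finset.mem_range]
        by_contra! hkj
        exact (hk.trans (monotone_norm_iterate x hkj)).not_gt hj.2
    _ = k := Finset.card_range k

theorem le_nearCount {n k : ℕ} {x : UnitAddCircle} (hkn : k ≤ n)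
    (h : ‖circleMap^[k] x‖ < 1 / 4) : k ≤ nearCount n x := by
  calc k = (Finset.range k).card := (Finset.card_range k).symm
    _ ≤ nearCount n x := Finset.card_le_card fun j hj => by
        rw [Finset.mem_range] at hj
        rw [Finset.mem_filter, Finset.mem_range]
        exact ⟨hj.trans_le hkn, (monotone_norm_iterate x hj.le).trans_lt h⟩

/-- The proportion of time up to `n` that the orbit of `x` spends in the quarter ball. -/
noncomputable def nearFraction (n : ℕ) (x : UnitAddCircle) : unitInterval :=
  ⟨nearCount (n + 1) x / (n + 1 : ℕ), by positivity,
    div_le_one_of_le₀ (by exact_mod_cast nearCount_le _ _) (by positivity)⟩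

theorem coe_nearFraction (n : ℕ) (x : UnitAddCircle) :
    (nearFraction n x : ℝ) = nearCount (n + 1) x / (n + 1 : ℕ) := rfl

theorem norm_sub_half (x : UnitAddCircle) :
    ‖x - ((1 / 2 : ℝ) : UnitAddCircle)‖ = 1 / 2 - ‖x‖ := by
  obtain ⟨r, hr, rfl⟩ := exists_rep x
  have hr' := abs_le.1 hr
  rw [norm_coe_eq_abs hr]
  rcases le_total 0 r with h | h
  · rw [← AddCircle.coe_sub, norm_coe_eq_abs, abs_of_nonpos, abs_of_nonneg h]
    · ring
    · linarith
    · rw [abs_le]; constructor <;> linarith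
  · have : (r : UnitAddCircle) - ((1 / 2 : ℝ) : UnitAddCircle) = ((r + 1 / 2 : ℝ) : UnitAddCircle) := by
      rw [← sub_eq_zero, ← AddCircle.coe_sub, ← AddCircle.coe_sub, AddCircle.coe_eq_zero_iff]
      exact ⟨-1, by norm_num; ring⟩
    rw [this, norm_coe_eq_abs, abs_of_nonneg, abs_of_nonpos h]
    · ring
    · linarith
    · rw [abs_le]; constructor <;> linarith

theorem integral_empiricalMeasure (n : ℕ) (x : UnitAddCircle) (g : UnitAddCircle → ℝ)
    (hg : Continuous g) :
    ∫ y, g y ∂(empiricalMeasure circleMap (n + 1) x : Measure UnitAddCircle) =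
      (∑ j ∈ Finset.range (n + 1), g (circleMap^[j] x)) / (n + 1 : ℕ) := by
  have : (empiricalMeasure circleMap (n + 1) x : Measure UnitAddCircle) =
    ((n + 1 : ℕ) : ENNReal)⁻¹ • ∑ j ∈ Finset.range (n + 1), Measure.dirac (circleMap^[j] x) := rfl
  rw [this, integral_smul_measure, integral_finsetSum_measure]
  · simp only [integral_dirac, smul_eq_mul, ENNReal.toReal_inv, ENNReal.toReal_natCast]
    rw [div_eq_inv_mul]
  · exact fun j _ => BoundedContinuousFunction.integrable _
      (BoundedContinuousFunction.mkOfCompact ⟨g, hg⟩)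

theorem integral_fixedMix_nearFraction (n : ℕ) (x : UnitAddCircle) (g : UnitAddCircle → ℝ)
    (hg : Continuous g) :
    ∫ y, g y ∂(fixedMix (nearFraction n x) : Measure UnitAddCircle) =
      (∑ j ∈ Finset.range (n + 1), if ‖circleMap^[j] x‖ < 1 / 4 then g 0
        else g ((1 / 2 : ℝ) : UnitAddCircle)) / (n + 1 : ℕ) := by
  have h := Finset.card_filter_add_card_filter_not (s := Finset.range (n + 1))
      (fun j => ‖circleMap^[j] x‖ < 1 / 4)
  rw [Finset.card_range] at h
  have h' : (((Finset.range (n + 1)).filter fun j => ¬ ‖circleMap^[j] x‖ < 1 / 4).card : ℝ) =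
      (n + 1 : ℕ) - nearCount (n + 1) x := by
    rw [eq_sub_iff_add_eq', nearCount]
    exact_mod_cast h
  rw [integral_fixedMix _ _ hg, Finset.sum_ite, Finset.sum_const, Finset.sum_const, nsmul_eq_mul,
    nsmul_eq_mul, h', coe_nearFraction, ← nearCount]
  have : ((n + 1 : ℕ) : ℝ) ≠ 0 := by positivity
  field_simp

/-- Empirical measures are uniformly close to mixtures of the two fixed-point masses. -/
theorem exists_forall_integral_empiricalMeasure_sub_le (g : UnitAddCircle → ℝ) (hg : Continuous g)
    {ε : ℝ} (hε : 0 < ε) :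
    ∃ N : ℕ, ∀ n ≥ N, ∀ x,
      |∫ y, g y ∂(empiricalMeasure circleMap (n + 1) x : Measure UnitAddCircle) -
        ∫ y, g y ∂(fixedMix (nearFraction n x) : Measure UnitAddCircle)| ≤ ε := by
  obtain ⟨M, hM⟩ := isCompact_univ.exists_bound_of_continuousOn hg.continuousOn
  replace hM : ∀ y, |g y| ≤ M := fun y => hM y trivial
  obtain ⟨δ₁, hδ₁, H₁⟩ := Metric.continuousAt_iff.1 (hg.continuousAt (x := 0)) (ε / 2) (half_pos hε)
  obtain ⟨δ₂, hδ₂, H₂⟩ := Metric.continuousAt_iff.1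
    (hg.continuousAt (x := ((1 / 2 : ℝ) : UnitAddCircle))) (ε / 2) (half_pos hε)
  set δ := min (min δ₁ δ₂) (1 / 4) with hδ
  have hδpos : 0 < δ := lt_min (lt_min hδ₁ hδ₂) (by norm_num)
  have hδ1 : δ ≤ δ₁ := (min_le_left _ _).trans (min_le_left _ _)
  have hδ2 : δ ≤ δ₂ := (min_le_left _ _).trans (min_le_right _ _)
  have hδ3 : δ ≤ 1 / 4 := min_le_right _ _
  obtain ⟨C, hC⟩ := exists_card_intermediate_le hδpos
  -- Near a fixed point continuity gives `ε / 2`; in the intermediate region the crude bound `2 * M`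
  -- is paid at most `C` times per orbit.
  have hpt : ∀ y : UnitAddCircle,
      |g y - if ‖y‖ < 1 / 4 then g 0 else g ((1 / 2 : ℝ) : UnitAddCircle)| ≤
        ε / 2 + if δ ≤ ‖y‖ ∧ ‖y‖ ≤ 1 / 2 - δ then 2 * M else 0 := by
    intro y
    by_cases hy : δ ≤ ‖y‖ ∧ ‖y‖ ≤ 1 / 2 - δ
    · rw [if_pos hy]
      refine (abs_sub _ _).trans ?_
      have h1 := hM y
      have h2 : |if ‖y‖ < 1 / 4 then g 0 else g ((1 / 2 : ℝ) : UnitAddCircle)| ≤ M := by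
        split_ifs <;> exact hM _
      linarith
    · rw [if_neg hy, add_zero]
      rcases lt_or_ge ‖y‖ δ with h | h
      · rw [if_pos (h.trans_le hδ3)]
        have := H₁ (x := y) (by rw [dist_zero_right]; exact h.trans_le hδ1)
        exact this.le
      · have h' : 1 / 2 - δ < ‖y‖ := not_le.1 fun h' => hy ⟨h, h'⟩
        rw [if_neg (by linarith)]
        have := H₂ (x := y) (by rw [dist_eq_norm, norm_sub_half]; linarith)
        exact this.le
  have hM0 : 0 ≤ M := (abs_nonneg _).trans (hM 0)
  refine ⟨⌈2 * M * C / (ε / 2)⌉₊, fun n hn x => ?_⟩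
  have hn' : 2 * M * C ≤ (n + 1 : ℕ) * (ε / 2) := by
    rw [← div_le_iff₀ (half_pos hε)]
    exact (Nat.le_ceil _).trans (by exact_mod_cast hn.trans n.le_succ)
  rw [integral_empiricalMeasure n x g hg, integral_fixedMix_nearFraction n x g hg, ← sub_div,
    ← Finset.sum_sub_distrib, abs_div, Nat.abs_cast, div_le_iff₀ (by positivity)]
  calc _ ≤ ∑ j ∈ Finset.range (n + 1), |g (circleMap^[j] x) -
          if ‖circleMap^[j] x‖ < 1 / 4 then g 0 else g ((1 / 2 : ℝ) : UnitAddCircle)| :=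
        Finset.abs_sum_le_sum_abs _ _
    _ ≤ ∑ j ∈ Finset.range (n + 1), (ε / 2 +
          if δ ≤ ‖circleMap^[j] x‖ ∧ ‖circleMap^[j] x‖ ≤ 1 / 2 - δ then 2 * M else 0) :=
        Finset.sum_le_sum fun j _ => hpt _
    _ = (n + 1 : ℕ) * (ε / 2) + ((Finset.range (n + 1)).filter fun j =>
          δ ≤ ‖circleMap^[j] x‖ ∧ ‖circleMap^[j] x‖ ≤ 1 / 2 - δ).card * (2 * M) := by
        rw [Finset.sum_add_distrib, ← Finset.sum_filter, Finset.sum_const, Finset.sum_const,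
          Finset.card_range, nsmul_eq_mul, nsmul_eq_mul]
    _ ≤ (n + 1 : ℕ) * (ε / 2) + C * (2 * M) := by gcongr; exact hC x (n + 1)
    _ ≤ ε * (n + 1 : ℕ) := by linarith

theorem tendsto_empiricalMeasure {ι : Type*} {l : Filter ι} {n : ι → ℕ} {x : ι → UnitAddCircle}
    {t : unitInterval} (hn : Tendsto n l atTop)
    (ht : Tendsto (fun i => nearFraction (n i) (x i)) l (𝓝 t)) :
    Tendsto (fun i => empiricalMeasure circleMap (n i + 1) (x i)) l (𝓝 (fixedMix t)) := by
  refine ProbabilityMeasure.tendsto_iff_forall_integral_tendsto.2 fun g => ?_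
  have h1 := ProbabilityMeasure.tendsto_iff_forall_integral_tendsto.1
    ((continuous_fixedMix.tendsto t).comp ht) g
  have h2 : Tendsto (fun i =>
      ∫ y, g y ∂(empiricalMeasure circleMap (n i + 1) (x i) : Measure UnitAddCircle) -
        ∫ y, g y ∂(fixedMix (nearFraction (n i) (x i)) : Measure UnitAddCircle)) l (𝓝 0) := by
    rw [Metric.tendsto_nhds]
    intro ε hε
    obtain ⟨N, hN⟩ := exists_forall_integral_empiricalMeasure_sub_le g g.continuous (half_pos hε)
    filter_upwards [hn.eventually_ge_atTop N] with i hi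
    rw [Real.dist_eq, sub_zero]
    exact (hN _ hi _).trans_lt (half_lt_self hε)
  simpa using h2.add h1

/-- Transfers membership in an open set from mixtures to empirical measures, uniformly in the
starting point; both large deviation bounds rest on it. -/
theorem eventually_empiricalMeasure_mem {K : Set unitInterval} (hK : IsCompact K)
    {G : Set (ProbabilityMeasure UnitAddCircle)} (hG : IsOpen G) (hKG : ∀ t ∈ K, fixedMix t ∈ G) :
    ∀ᶠ n in atTop, ∀ x, nearFraction n x ∈ K → empiricalMeasure circleMap (n + 1) x ∈ G := by
  by_contra hcon
  rw [not_eventually] at hcon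
  set S : Set (ℕ × UnitAddCircle) :=
    {p | nearFraction p.1 p.2 ∈ K ∧ empiricalMeasure circleMap (p.1 + 1) p.2 ∉ G} with hS
  -- The counterexamples `(n, x)` with `n → ∞` form a nontrivial filter. Compactness of `K` gives a
  -- cluster point `t` of the near fractions, and refining the filter makes the empirical measures
  -- converge to `fixedMix t ∈ G`.
  have hne : (comap Prod.fst atTop ⊓ 𝓟 S).NeBot := by
    rw [← frequently_mem_iff_neBot, frequently_comap]
    refine hcon.mono fun n hn => ?_
    push Not at hn
    obtain ⟨x, hx⟩ := hn
    exact ⟨(n, x), rfl, hx⟩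
  have hmem : S ∈ comap (Prod.fst : ℕ × UnitAddCircle → ℕ) atTop ⊓ 𝓟 S :=
    mem_inf_of_right (mem_principal_self S)
  obtain ⟨t, htK, ht⟩ := hK (f := map (fun p : ℕ × UnitAddCircle => nearFraction p.1 p.2)
    (comap Prod.fst atTop ⊓ 𝓟 S)) (by
      rw [le_principal_iff, mem_map]
      exact mem_of_superset hmem fun p hp => hp.1)
  have hne' : ((comap Prod.fst atTop ⊓ 𝓟 S) ⊓
      comap (fun p : ℕ × UnitAddCircle => nearFraction p.1 p.2) (𝓝 t)).NeBot := by
    rw [inf_comm, ← map_neBot_iff (fun p : ℕ × UnitAddCircle => nearFraction p.1 p.2),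
      Filter.push_pull']
    exact ht
  have hlim := tendsto_empiricalMeasure (n := Prod.fst) (x := Prod.snd)
    (l := (comap Prod.fst atTop ⊓ 𝓟 S) ⊓
      comap (fun p : ℕ × UnitAddCircle => nearFraction p.1 p.2) (𝓝 t)) (t := t)
    (tendsto_comap.mono_left (inf_le_left.trans inf_le_left))
    (tendsto_comap.mono_left inf_le_right)
  obtain ⟨p, hpG, hpS⟩ := ((hlim.eventually (hG.mem_nhds (hKG t htK))).and
    (mem_inf_of_left hmem)).exists
  exact hpS.2 hpG


/-! ### Exponential rates and the lower bound -/

theorem le_liminf_log_div {u : ℕ → ENNReal} {v : ℕ → ℝ} {b : ℝ}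
    (hu : ∀ᶠ n in atTop, ENNReal.ofReal (Real.exp (v n)) ≤ u n)
    (hv : Tendsto (fun n => v n / (n + 1 : ℕ)) atTop (𝓝 b)) :
    (b : EReal) ≤ liminf (fun n : ℕ => ENNReal.log (u n) / ((n + 1 : ℕ) : EReal)) atTop := by
  rw [← ((continuous_coe_real_ereal.tendsto b).comp hv).liminf_eq]
  refine liminf_le_liminf (hu.mono fun n hn => ?_)
  have := ENNReal.log_monotone hn
  rw [ENNReal.log_ofReal_of_pos (Real.exp_pos _), Real.log_exp] at this
  exact EReal.div_le_div_right_of_nonneg (c := ((n + 1 : ℕ) : EReal)) (Nat.cast_nonneg' _) this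

theorem limsup_log_div_le {u : ℕ → ENNReal} {v : ℕ → ℝ} {b : ℝ}
    (hu : ∀ᶠ n in atTop, u n ≤ ENNReal.ofReal (Real.exp (v n)))
    (hv : Tendsto (fun n => v n / (n + 1 : ℕ)) atTop (𝓝 b)) :
    limsup (fun n : ℕ => ENNReal.log (u n) / ((n + 1 : ℕ) : EReal)) atTop ≤ (b : EReal) := by
  rw [← ((continuous_coe_real_ereal.tendsto b).comp hv).limsup_eq]
  refine limsup_le_limsup (hu.mono fun n hn => ?_)
  have := ENNReal.log_monotone hn
  rw [ENNReal.log_ofReal_of_pos (Real.exp_pos _), Real.log_exp] at this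
  exact EReal.div_le_div_right_of_nonneg (c := ((n + 1 : ℕ) : EReal)) (Nat.cast_nonneg' _) this

theorem tendsto_succ_floor_mul_div {t : ℝ} (ht : 0 ≤ t) :
    Tendsto (fun n : ℕ => (⌊t * (n + 1 : ℕ)⌋₊ : ℝ) / (n + 1 : ℕ)) atTop (𝓝 t) :=
  ((tendsto_nat_floor_mul_div_atTop ht).comp tendsto_natCast_atTop_atTop).comp
    (tendsto_add_atTop_nat 1)

theorem tendsto_const_div_succ (c : ℝ) :
    Tendsto (fun n : ℕ => c / (n + 1 : ℕ)) atTop (𝓝 0) :=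
  (tendsto_const_div_atTop_nhds_zero_nat c).comp (tendsto_add_atTop_nat 1)

theorem log_multiplier_pos : 0 < Real.log multiplier := Real.log_pos one_lt_multiplier

/-- Points whose distance to `0` is of order `multiplier ^ (-k)`. -/
def escapeAnnulus (k : ℕ) : Set UnitAddCircle :=
  Metric.closedBall 0 ((multiplier ^ k)⁻¹ / 5) \ Metric.closedBall 0 ((multiplier ^ k)⁻¹ / 10)

theorem le_volume_escapeAnnulus (k : ℕ) :
    ENNReal.ofReal (Real.exp (-(k * Real.log multiplier) - Real.log 5)) ≤
      volume (escapeAnnulus k) := by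
  have hpos : 0 < (multiplier ^ k)⁻¹ := inv_pos.2 (pow_pos multiplier_pos k)
  have hle : (multiplier ^ k)⁻¹ ≤ 1 := inv_le_one_of_one_le₀ (one_le_pow₀ one_lt_multiplier.le)
  have hexp : Real.exp (-(k * Real.log multiplier) - Real.log 5) = (multiplier ^ k)⁻¹ / 5 := by
    rw [Real.exp_sub, Real.exp_log (by norm_num), Real.exp_neg, ← Real.log_pow,
      Real.exp_log (pow_pos multiplier_pos k)]
  refine le_trans ?_ le_measure_sdiff
  rw [AddCircle.volume_closedBall, AddCircle.volume_closedBall, hexp, min_eq_right (by linarith),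
    min_eq_right (by linarith), ← ENNReal.ofReal_sub _ (by linarith)]
  exact ENNReal.ofReal_le_ofReal (by linarith)

-- The outer radius is chosen so that `k` expansions by at most `multiplier` reach only `1/5 < 1/4`.
theorem le_nearCount_of_mem_escapeAnnulus {n k : ℕ} (hk : k ≤ n) {x : UnitAddCircle}
    (hx : x ∈ escapeAnnulus k) : k ≤ nearCount n x := by
  refine le_nearCount hk ((norm_iterate_le x k).trans_lt ?_)
  have h := hx.1
  rw [mem_closedBall_zero_iff, le_div_iff₀ (by norm_num)] at h
  have hpos := pow_pos multiplier_pos k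
  have := mul_le_mul_of_nonneg_left h hpos.le
  rw [mul_inv_cancel₀ hpos.ne'] at this
  linarith

/-- The escape time from an annulus of radius `multiplier ^ (-k)` is not much larger than `k`. -/
theorem exists_nearCount_mul_log_le {a : ℝ} (ha1 : 1 < a) (ha : a < multiplier) :
    ∃ D : ℝ, ∀ (n k : ℕ), ∀ x ∈ escapeAnnulus k,
      nearCount n x * Real.log a ≤ k * Real.log multiplier + D := by
  obtain ⟨C, hC1, hC⟩ := exists_norm_mul_pow_le ha1 ha
  have hC0 : 0 < C := one_pos.trans_le hC1
  have hloga := Real.log_pos ha1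
  refine ⟨Real.log (10 * C) + Real.log a, fun n k x hx => ?_⟩
  rcases Nat.eq_zero_or_pos (nearCount n x) with h | h
  · rw [h, Nat.cast_zero, zero_mul]
    have := log_multiplier_pos
    have := Real.log_nonneg (x := 10 * C) (by linarith)
    positivity
  -- The last time in the quarter ball is `m = nearCount n x - 1`; this shift accounts for the term
  -- `log a` in the constant.
  · obtain ⟨m, hm⟩ := Nat.exists_eq_add_of_lt h
    rw [zero_add] at hm
    have h1 := hC x m (norm_iterate_lt_of_lt_nearCount (n := n) (by omega))
    have hlam : 0 < multiplier ^ k := pow_pos multiplier_pos k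
    have ham : 0 < a ^ m := pow_pos (one_pos.trans ha1) m
    have h2 : (multiplier ^ k)⁻¹ / 10 < ‖x‖ := by
      simpa [mem_closedBall_zero_iff] using hx.2
    have h3 : a ^ m ≤ multiplier ^ k * (10 * C) := by
      rw [div_lt_iff₀ (by norm_num), inv_lt_iff_one_lt_mul₀ hlam] at h2
      nlinarith
    have h4 := Real.log_le_log ham h3
    rw [Real.log_mul hlam.ne' (by positivity), Real.log_pow, Real.log_pow] at h4
    rw [hm]
    push_cast
    linarith

theorem eventually_nearFraction_mem_closedBall (t : unitInterval) {η : ℝ} (hη : 0 < η) :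
    ∀ᶠ n : ℕ in atTop, ∀ x ∈ escapeAnnulus ⌊(t : ℝ) * (n + 1 : ℕ)⌋₊,
      nearFraction n x ∈ Metric.closedBall t η := by
  have ht := t.2.1
  have hL := log_multiplier_pos
  -- The rate `β` is close enough to `log multiplier` that `t * log multiplier < (t + η) * β`, so
  -- the slack in the escape time costs less than `η`.
  obtain ⟨β, hβ1, hβ2⟩ : ∃ β, t / (t + η) * Real.log multiplier < β ∧ β < Real.log multiplier :=
    exists_between (mul_lt_of_lt_one_left hL ((div_lt_one (by positivity)).2 (by linarith)))
  have hβ0 : 0 < β := lt_of_le_of_lt (by positivity) hβ1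
  obtain ⟨D, hD⟩ := exists_nearCount_mul_log_le (a := Real.exp β) (Real.one_lt_exp_iff.2 hβ0)
    (by rwa [← Real.lt_log_iff_exp_lt multiplier_pos])
  rw [Real.log_exp] at hD
  have hfl := tendsto_succ_floor_mul_div ht
  have hup : ∀ᶠ n : ℕ in atTop, (⌊(t : ℝ) * (n + 1 : ℕ)⌋₊ : ℝ) / (n + 1 : ℕ) *
      Real.log multiplier + D / (n + 1 : ℕ) < (t + η) * β := by
    refine ((hfl.mul_const _).add (tendsto_const_div_succ D)).eventually_lt_const ?_
    rw [add_zero]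
    rwa [div_mul_eq_mul_div, div_lt_iff₀ (by positivity), mul_comm β] at hβ1
  filter_upwards [hup, hfl.eventually_const_lt (sub_lt_self (t : ℝ) hη)] with n h1 h2 x hx
  have hn : (0 : ℝ) < (n + 1 : ℕ) := by positivity
  have hk : ⌊(t : ℝ) * (n + 1 : ℕ)⌋₊ ≤ n + 1 :=
    Nat.floor_le_of_le (mul_le_of_le_one_left hn.le t.2.2)
  rw [Metric.mem_closedBall, Subtype.dist_eq, Real.dist_eq, abs_le, coe_nearFraction]
  constructor
  · have : (⌊(t : ℝ) * (n + 1 : ℕ)⌋₊ : ℝ) / (n + 1 : ℕ) ≤ nearCount (n + 1) x / (n + 1 : ℕ) := by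
      gcongr
      exact le_nearCount_of_mem_escapeAnnulus hk hx
    linarith
  · have h3 := hD (n + 1) _ x hx
    have h4 : nearCount (n + 1) x / (n + 1 : ℕ) * β ≤
        (⌊(t : ℝ) * (n + 1 : ℕ)⌋₊ : ℝ) / (n + 1 : ℕ) * Real.log multiplier + D / (n + 1 : ℕ) := by
      rw [div_mul_eq_mul_div, div_mul_eq_mul_div, ← add_div]
      gcongr
    have := lt_of_mul_lt_mul_right (h4.trans_lt h1) hβ0.le
    linarith

/-- Only mixtures matter. For `fixedMix t ∈ G`, the annulus with index `⌊t * (n + 1)⌋₊` eventually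
lies in the event, and its volume decays at the required rate. -/
theorem freeEnergy_lower_bound (G : Set (ProbabilityMeasure UnitAddCircle)) (hG : IsOpen G) :
    ⨆ μ ∈ G, freeEnergy circleMap circlePotential μ ≤
      liminf (fun n : ℕ =>
        ENNReal.log ((lebesgueCircle : Measure UnitAddCircle)
          {x | empiricalMeasure circleMap (n + 1) x ∈ G}) / ((n + 1 : ℕ) : EReal)) atTop := by
  refine iSup₂_le fun μ hμ => ?_
  rcases freeEnergy_eq_bot_or μ with h | ⟨t, rfl⟩
  · rw [h]; exact bot_le
  rw [freeEnergy_fixedMix]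
  obtain ⟨η, hη, hball⟩ := Metric.nhds_basis_closedBall.mem_iff.1
    (continuous_fixedMix.continuousAt.preimage_mem_nhds (hG.mem_nhds hμ))
  refine le_liminf_log_div
    (v := fun n => -(⌊(t : ℝ) * (n + 1 : ℕ)⌋₊ * Real.log multiplier) - Real.log 5) ?_ ?_
  · filter_upwards [eventually_nearFraction_mem_closedBall t hη,
      eventually_empiricalMeasure_mem (isCompact_closedBall t η) hG hball] with n h1 h2
    exact (le_volume_escapeAnnulus _).trans (measure_mono fun x hx => h2 x (h1 x hx))
  · have := ((tendsto_succ_floor_mul_div t.2.1).mul_const (Real.log multiplier)).neg.sub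
      (tendsto_const_div_succ (Real.log 5))
    rw [sub_zero] at this
    refine this.congr fun n => ?_
    ring

/-! ### The upper bound -/

theorem freeEnergy_upper_bound (F : Set (ProbabilityMeasure UnitAddCircle)) (hF : IsClosed F) :
    limsup (fun n : ℕ =>
        ENNReal.log ((lebesgueCircle : Measure UnitAddCircle)
          {x | empiricalMeasure circleMap (n + 1) x ∈ F}) / ((n + 1 : ℕ) : EReal)) atTop ≤
      ⨆ μ ∈ F, freeEnergy circleMap circlePotential μ := by
  refine EReal.le_of_forall_lt_iff_le.1 fun b hb => ?_
  rcases le_or_gt 0 b with hb0 | hb0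
  · refine (limsup_log_div_le (v := fun _ => 0) (b := 0) (Eventually.of_forall fun n => ?_)
      (by simp)).trans (by exact_mod_cast hb0)
    rw [Real.exp_zero, ENNReal.ofReal_one]
    exact prob_le_one
  -- The gap `b₁ < b` provides room for an expansion rate `-b / s` strictly below `log multiplier =
  -- -b₁ / s`.
  obtain ⟨b₁, hcb, hbb⟩ := EReal.lt_iff_exists_real_btwn.1 hb
  rw [EReal.coe_lt_coe_iff] at hbb
  have hb1 : b₁ < 0 := hbb.trans hb0
  have hL := log_multiplier_pos
  set s := -b₁ / Real.log multiplier with hs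
  have hs0 : 0 < s := div_pos (neg_pos.2 hb1) hL
  have hsL : s * Real.log multiplier = -b₁ := div_mul_cancel₀ _ hL.ne'
  have hβ0 : 0 < -b / s := div_pos (neg_pos.2 hb0) hs0
  have hβ : -b / s < Real.log multiplier := by
    rw [div_lt_iff₀ hs0, mul_comm, hsL]; linarith
  obtain ⟨C, hC1, hC⟩ := exists_norm_mul_pow_le (a := Real.exp (-b / s))
    (Real.one_lt_exp_iff.2 hβ0) (by rwa [← Real.lt_log_iff_exp_lt multiplier_pos])
  have hK : IsCompact {t : unitInterval | (t : ℝ) ≤ s} :=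
    (isClosed_le continuous_subtype_val continuous_const).isCompact
  -- For `t ≤ s` the free energy of the mixture is at least `b₁`, above the supremum over `F`.
  -- Eventually the event therefore forces a near fraction above `s`, hence a start in an
  -- exponentially small ball.
  have hKF : ∀ t ∈ {t : unitInterval | (t : ℝ) ≤ s}, fixedMix t ∈ Fᶜ := by
    intro t ht hmem
    have h1 := (le_iSup₂ (f := fun μ (_ : μ ∈ F) => freeEnergy circleMap circlePotential μ)
      (fixedMix t) hmem).trans_lt hcb
    rw [freeEnergy_fixedMix, EReal.coe_lt_coe_iff] at h1
    have h2 : (t : ℝ) * Real.log multiplier ≤ s * Real.log multiplier :=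
      mul_le_mul_of_nonneg_right ht hL.le
    linarith
  refine limsup_log_div_le
    (v := fun n => Real.log (2 * C) - ⌊s * (n + 1 : ℕ)⌋₊ * (-b / s)) ?_ ?_
  · filter_upwards [eventually_empiricalMeasure_mem hK hF.isOpen_compl hKF] with n hn
    set k := ⌊s * (n + 1 : ℕ)⌋₊ with hk
    have hpow : 0 < Real.exp (-b / s) ^ k := pow_pos (Real.exp_pos _) _
    have hsub : {x | empiricalMeasure circleMap (n + 1) x ∈ F} ⊆
        Metric.closedBall 0 (C / Real.exp (-b / s) ^ k) := by
      intro x hx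
      have h1 : s < nearFraction n x := not_le.1 fun h => hn x h hx
      rw [coe_nearFraction, lt_div_iff₀ (by positivity)] at h1
      have h2 : k < nearCount (n + 1) x := by
        exact_mod_cast (Nat.floor_le (by positivity)).trans_lt h1
      rw [mem_closedBall_zero_iff, le_div_iff₀ hpow]
      exact hC x k (norm_iterate_lt_of_lt_nearCount h2)
    have hexp : Real.exp (Real.log (2 * C) - k * (-b / s)) =
        2 * (C / Real.exp (-b / s) ^ k) := by
      rw [Real.exp_sub, Real.exp_log (by linarith), Real.exp_nat_mul, mul_div_assoc]
    rw [hexp]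
    refine (measure_mono hsub).trans ((AddCircle.volume_closedBall (T := 1) _).trans_le ?_)
    exact ENNReal.ofReal_le_ofReal (min_le_right _ _)
  · have := (tendsto_const_div_succ (Real.log (2 * C))).sub
      ((tendsto_succ_floor_mul_div hs0.le).mul_const (-b / s))
    rw [zero_sub, mul_div_cancel₀ _ hs0.ne', neg_neg] at this
    refine this.congr fun n => ?_
    ring

end LevelTwo

theorem proposition6p2 :
    LevelTwo.nonWanderingSet LevelTwo.circleMap = {0, ((1 / 2 : ℝ) : UnitAddCircle)} ∧
    (∀ μ : MeasureTheory.ProbabilityMeasure UnitAddCircle,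
      MeasureTheory.MeasurePreserving LevelTwo.circleMap
        (μ : MeasureTheory.Measure UnitAddCircle) (μ : MeasureTheory.Measure UnitAddCircle) →
      LevelTwo.metricEntropy LevelTwo.circleMap (μ : MeasureTheory.Measure UnitAddCircle) = 0) ∧
    LevelTwo.IsRateFunction LevelTwo.circleMap LevelTwo.lebesgueCircle
      (LevelTwo.freeEnergy LevelTwo.circleMap LevelTwo.circlePotential) :=
  ⟨LevelTwo.nonWanderingSet_circleMap, LevelTwo.metricEntropy_circleMap,
    LevelTwo.upperSemicontinuous_freeEnergy, LevelTwo.freeEnergy_nonpos,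
    LevelTwo.freeEnergy_lower_bound, LevelTwo.freeEnergy_upper_bound⟩
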